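/- Let $\Delta$ be a semiregular right-angled building over a finite index set $I$; that is, $\Delta$ is a building of type $M=(m_{ij})_{i,j\in I}$ with $m_{ij}\in\{2,\infty\}$ for all distinct $i,j\in I$, and for each $i\in I$ all $i$-panels of $\Delta$ have the same (possibly infinite) cardinality $q_i\geq 2$. Then any finite set of chambers of $\Delta$ is contained in a finite convex set of chambers. Here a set of chambers is convex if it contains all chambers of every minimal gallery between two of its members. -/

import Mathlib

universe u v

/-- A Coxeter matrix is right-angled if `m i j` is `2` or `∞` for all distinct `i`, `j`.
In Mathlib the entry `∞` of a Coxeter matrix is encoded as `0`. -/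
def CoxeterMatrix.IsRightAngled {I : Type*} (M : CoxeterMatrix I) : Prop :=
  ∀ i j : I, i ≠ j → M i j = 2 ∨ M i j = 0

/-- A chamber system over `I` with set of chambers `C`: every `i : I` determines an equivalence
relation on `C`, whose classes are the `i`-panels. -/
structure ChamberSystem (I C : Type*) where
  /-- The partition of the chambers into `i`-panels. -/
  panelSetoid : I → Setoid C

namespace ChamberSystem

variable {I C : Type*}

/-- The `i`-panel containing the chamber `c`. -/
def panel (S : ChamberSystem I C) (i : I) (c : C) : Set C :=
  {d | (S.panelSetoid i) c d}

/-- `i`-adjacency: two distinct chambers in a common `i`-panel. -/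
def Adj (S : ChamberSystem I C) (i : I) (c d : C) : Prop :=
  c ≠ d ∧ (S.panelSetoid i) c d

/-- `S.IsGallery c f γ d`: the list of chambers `γ` (which includes both ends) is a gallery
of type `f` from `c` to `d`. -/
inductive IsGallery (S : ChamberSystem I C) : C → List I → List C → C → Prop
  | nil (c : C) : IsGallery S c [] [c] c
  | cons {i : I} {f : List I} {c d e : C} {γ : List C} :
      S.Adj i c d → IsGallery S d f γ e → IsGallery S c (i :: f) (c :: γ) e

/-- `γ` is a minimal gallery from `c` to `d`: no gallery from `c` to `d` has fewer chambers. -/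
def IsMinimalGallery (S : ChamberSystem I C) (c : C) (γ : List C) (d : C) : Prop :=
  (∃ f : List I, S.IsGallery c f γ d) ∧
    ∀ (f' : List I) (γ' : List C), S.IsGallery c f' γ' d → γ.length ≤ γ'.length

/-- A set of chambers is convex if it contains all chambers of every minimal gallery whose two
ends lie in the set. -/
def IsConvex (S : ChamberSystem I C) (B : Set C) : Prop :=
  ∀ c ∈ B, ∀ d ∈ B, ∀ γ : List C, S.IsMinimalGallery c γ d → ∀ e ∈ γ, e ∈ B

/-- `S` is semiregular with parameters `q`: each `q i` is at least `2`, and all `i`-panels have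
the same, possibly infinite, cardinality `q i`. -/
def IsSemiregular {C : Type v} (S : ChamberSystem I C) (q : I → Cardinal.{v}) : Prop :=
  ∀ i : I, 2 ≤ q i ∧ ∀ c : C, Cardinal.mk (S.panel i c) = q i

end ChamberSystem

/-- A building of type `M`: a chamber system over `I` in which every panel has at least two
chambers, with a distance function `δ` to the Coxeter group of `M` such that, for each reduced
word `f`, one has `δ c d = r_f` if and only if there is a gallery of type `f` from `c` to `d`. -/
structure Building {I : Type*} (M : CoxeterMatrix I) (C : Type*) extends ChamberSystem I C where
  exists_adj : ∀ (i : I) (c : C), ∃ d : C, toChamberSystem.Adj i c d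
  /-- The Weyl distance. -/
  δ : C → C → M.Group
  δ_eq_iff : ∀ f : List I, M.toCoxeterSystem.IsReduced f → ∀ c d : C,
    δ c d = M.toCoxeterSystem.wordProd f ↔ ∃ γ : List C, toChamberSystem.IsGallery c f γ d

/-!
Projecting all chambers onto a fixed panel partitions them into wings. These partitions behave like
the walls of a Coxeter complex: two distinct chambers are separated by at least one and only
finitely many of them, and a minimal gallery crosses each of them at most once. The chambers that no
partition separates from all of `F` therefore form a finite convex set.

The panels crossed by a gallery already give all the partitions separating its ends, because a panel
whose projection is changed by crossing another panel is parallel to it, and parallel panels have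
the same wings. This rests on the descents of a right-angled Coxeter group, which are read off from
the signs of the coordinates of a vector in the dual of the geometric representation.
-/

theorem finite_setOf_forall_exists_rel {X : Type*} {P : Set (Setoid X)}
    (eq_of_rel : ∀ x y, (∀ W ∈ P, W x y) → x = y)
    (finite_not_rel : ∀ x y, {W ∈ P | ¬ W x y}.Finite) {F : Set X} (hF : F.Finite) :
    {x | ∀ W ∈ P, ∃ f ∈ F, W x f}.Finite := by
  let T : Set (Setoid X) := ⋃ f ∈ F, ⋃ g ∈ F, {W ∈ P | ¬ W f g}
  have hTP : T ⊆ P := Set.iUnion₂_subset fun f _ => Set.iUnion₂_subset fun g _ W hW => hW.1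
  have : Finite T := hF.biUnion fun f _ => hF.biUnion fun g _ => finite_not_rel f g
  have hfinite : (Set.univ.pi fun W : T => Quotient.mk W.1 '' F).Finite :=
    Set.Finite.pi fun W => hF.image _
  refine hfinite.of_injOn (f := fun x (W : T) => Quotient.mk W.1 x) ?_ ?_
  · intro x hx W _
    obtain ⟨f, hf, hxf⟩ := hx W (hTP W.2)
    exact ⟨f, hf, (Quotient.sound hxf).symm⟩
  · intro x hx y hy hxy
    refine eq_of_rel x y fun W hW => ?_
    by_cases hWT : W ∈ T
    · exact Quotient.exact (congrFun hxy ⟨W, hWT⟩)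
    · obtain ⟨f, hf, hxf⟩ := hx W hW
      obtain ⟨g, hg, hyg⟩ := hy W hW
      have hfg : W f g := by
        by_contra hfg
        exact hWT (Set.mem_biUnion hf (Set.mem_biUnion hg ⟨hW, hfg⟩))
      exact W.trans' hxf (W.trans' hfg (W.symm' hyg))

namespace RightAngledCoxeter

variable {I W : Type*} [Group W] {M : CoxeterMatrix I} (cs : CoxeterSystem M W)

theorem commute_simple_of_eq_two {i k : I} (h : M i k = 2) :
    Commute (cs.simple i) (cs.simple k) := by
  have hsq : (cs.simple i * cs.simple k) * (cs.simple i * cs.simple k) = 1 := by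
    rw [← pow_two, ← h, cs.simple_mul_simple_pow]
  simpa only [mul_inv_rev, cs.inv_simple, commute_iff_eq] using eq_inv_of_mul_eq_one_left hsq

theorem isReduced_pair {i k : I} (h : cs.simple i ≠ cs.simple k) : cs.IsReduced [i, k] := by
  rw [CoxeterSystem.IsReduced, cs.wordProd_cons, cs.wordProd_singleton]
  refine ((cs.length_simple_mul _ i).resolve_right fun hlt => h ?_).trans
    (by rw [cs.length_simple]; rfl)
  rw [cs.length_simple, Nat.add_eq_right, cs.length_eq_zero_iff] at hlt
  rw [eq_inv_of_mul_eq_one_left hlt, cs.inv_simple]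

theorem length_mul_simple_of_isLeftDescent {w : W} {i j : I} (hw : ¬ cs.IsLeftDescent w i)
    (hwj : cs.IsLeftDescent (w * cs.simple j) i) :
    cs.length (w * cs.simple j) = cs.length w + 1 := by
  rw [cs.not_isLeftDescent_iff] at hw
  rw [cs.isLeftDescent_iff, ← mul_assoc] at hwj
  have h₁ := cs.length_mul_simple w j
  have h₂ := cs.length_mul_simple (cs.simple i * w) j
  omega

theorem isLeftDescent_mul_simple {w : W} {j k : I} (hw : cs.IsLeftDescent w k)
    (hj : cs.length (w * cs.simple j) = cs.length w + 1) :
    cs.IsLeftDescent (w * cs.simple j) k := by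
  rw [cs.isLeftDescent_iff] at hw
  rw [CoxeterSystem.IsLeftDescent, hj, ← mul_assoc]
  have h := cs.length_mul_simple (cs.simple k * w) j
  omega

theorem isLeftDescent_simple_mul_of_eq_two {w : W} {i k : I} (h : M i k = 2)
    (hi : cs.IsLeftDescent w i) (hk : ¬ cs.IsLeftDescent w k) :
    cs.IsLeftDescent (cs.simple k * w) i := by
  rw [cs.isLeftDescent_iff] at hi
  rw [cs.not_isLeftDescent_iff] at hk
  rw [CoxeterSystem.IsLeftDescent, hk, ← mul_assoc, (commute_simple_of_eq_two cs h).eq, mul_assoc]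
  have hle := cs.length_simple_mul (cs.simple i * w) k
  omega

variable (M) in
/-- The generalized Cartan matrix of a right-angled Coxeter matrix: twice the Gram matrix of the
geometric representation. The condition `M i j = 1` says `i = j`, and the value `-2` is intended
for `m i j = ∞`. -/
def cartanMatrix (i j : I) : ℤ :=
  if M i j = 1 then 2 else if M i j = 2 then 0 else -2

variable (M) in
/-- The action of the `i`-th simple reflection on the dual of the geometric representation, where a
linear form is recorded by its values on the simple roots. -/
def dualReflection (i : I) : Module.End ℤ (I → ℤ) :=
  Module.preReflection (cartanMatrix M i) (LinearMap.proj i)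

theorem dualReflection_apply (i j : I) (x : I → ℤ) :
    dualReflection M i x j = x j - x i * cartanMatrix M i j := rfl

theorem dualReflection_mul_self (i : I) : dualReflection M i * dualReflection M i = 1 :=
  LinearMap.ext <| Module.involutive_preReflection (by simp [cartanMatrix])

theorem commute_dualReflection {i k : I} (h : M i k = 2) :
    Commute (dualReflection M i) (dualReflection M k) := by
  have h' : M k i = 2 := M.symmetric i k ▸ h
  refine LinearMap.ext fun x => funext fun j => ?_
  simp only [Module.End.mul_apply, dualReflection_apply, cartanMatrix, h, h']
  norm_num
  ring

theorem isLiftable_dualReflection (hM : M.IsRightAngled) : M.IsLiftable (dualReflection M) := by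
  intro i k
  obtain rfl | hik := eq_or_ne i k
  · rw [M.diagonal, pow_one, dualReflection_mul_self]
  · rcases hM i k hik with h | h
    · rw [h, (commute_dualReflection h).mul_pow, pow_two, pow_two, dualReflection_mul_self,
        dualReflection_mul_self, one_mul]
    · rw [h, pow_zero]

variable (hM : M.IsRightAngled)

/-- Let `x` be the linear form on the geometric representation that is `1` on all simple roots, a
point of the fundamental chamber. `rootPairing cs hM w i` is the value of `w x` on the `i`-th simple
root; its sign tells on which side of the wall of `i` the chamber `w` lies. -/
def rootPairing (w : W) : I → ℤ :=
  cs.lift ⟨dualReflection M, isLiftable_dualReflection hM⟩ w 1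

theorem rootPairing_one (i : I) : rootPairing cs hM 1 i = 1 := by
  simp [rootPairing]

theorem rootPairing_simple_mul (i j : I) (w : W) :
    rootPairing cs hM (cs.simple i * w) j =
      rootPairing cs hM w j - rootPairing cs hM w i * cartanMatrix M i j := by
  rw [rootPairing, map_mul, cs.lift_apply_simple, Module.End.mul_apply, dualReflection_apply]
  rfl

theorem rootPairing_simple_mul_self (i : I) (w : W) :
    rootPairing cs hM (cs.simple i * w) i = -rootPairing cs hM w i := by
  rw [rootPairing_simple_mul, cartanMatrix, if_pos (M.diagonal i)]
  ring

theorem rootPairing_simple_mul_of_eq_two {i j : I} (h : M i j = 2) (w : W) :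
    rootPairing cs hM (cs.simple i * w) j = rootPairing cs hM w j := by
  rw [rootPairing_simple_mul, cartanMatrix, h]
  norm_num

theorem rootPairing_simple_mul_of_eq_zero {i j : I} (h : M i j = 0) (w : W) :
    rootPairing cs hM (cs.simple i * w) j =
      rootPairing cs hM w j + 2 * rootPairing cs hM w i := by
  rw [rootPairing_simple_mul, cartanMatrix, h]
  norm_num
  ring

theorem rootPairing_simple_mul_add {i k : I} (h : M i k = 0) (w : W) :
    rootPairing cs hM (cs.simple i * w) i + rootPairing cs hM (cs.simple i * w) k =
      rootPairing cs hM w i + rootPairing cs hM w k := by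
  rw [rootPairing_simple_mul_self, rootPairing_simple_mul_of_eq_zero cs hM h]
  ring

theorem rootPairing_simple_mul_pos {w : W} {i k : I}
    (pos : ∀ j, ¬ cs.IsLeftDescent w j → 0 < rootPairing cs hM w j)
    (add_pos : ∀ j, M k j = 0 → 0 < rootPairing cs hM w k + rootPairing cs hM w j)
    (hk : ¬ cs.IsLeftDescent w k) (hi : ¬ cs.IsLeftDescent (cs.simple k * w) i) :
    0 < rootPairing cs hM (cs.simple k * w) i := by
  have hki : k ≠ i := by
    rintro rfl
    rw [cs.isLeftDescent_iff_not_isLeftDescent_mul, cs.simple_mul_simple_cancel_left] at hi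
    exact hi hk
  rcases hM k i hki with h | h
  · rw [rootPairing_simple_mul_of_eq_two cs hM h]
    exact pos i fun hiw =>
      hi (isLeftDescent_simple_mul_of_eq_two cs (M.symmetric k i ▸ h) hiw hk)
  · rw [rootPairing_simple_mul_of_eq_zero cs hM h]
    linarith [add_pos i h, pos k hk]

-- For `m i k = ∞` the sum of the two simple roots is fixed by both reflections; carrying its
-- positivity through the induction replaces the usual analysis of dihedral subgroups.
theorem rootPairing_pos_and_add_pos (w : W) :
    (∀ i, ¬ cs.IsLeftDescent w i → 0 < rootPairing cs hM w i) ∧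
      ∀ i k, M i k = 0 → 0 < rootPairing cs hM w i + rootPairing cs hM w k := by
  induction hn : cs.length w using Nat.strong_induction_on generalizing w with
  | _ n ih =>
    subst hn
    have pos : ∀ i, ¬ cs.IsLeftDescent w i → 0 < rootPairing cs hM w i := by
      intro i hi
      obtain rfl | hw := eq_or_ne w 1
      · rw [rootPairing_one]
        exact one_pos
      obtain ⟨k, hk⟩ := cs.exists_leftDescent_of_ne_one hw
      obtain ⟨pos, add_pos⟩ := ih _ hk _ rfl
      rw [← cs.simple_mul_simple_cancel_left (w := w) k] at hi ⊢
      exact rootPairing_simple_mul_pos cs hM pos (add_pos k)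
        (cs.isLeftDescent_iff_not_isLeftDescent_mul.1 hk) hi
    have add_pos_of_isLeftDescent : ∀ i k, M i k = 0 → cs.IsLeftDescent w i →
        0 < rootPairing cs hM w i + rootPairing cs hM w k := by
      intro i k h hi
      rw [← rootPairing_simple_mul_add cs hM h]
      exact (ih _ hi _ rfl).2 i k h
    refine ⟨pos, fun i k h => ?_⟩
    by_cases hi : cs.IsLeftDescent w i
    · exact add_pos_of_isLeftDescent i k h hi
    by_cases hk : cs.IsLeftDescent w k
    · rw [add_comm]
      exact add_pos_of_isLeftDescent k i (M.symmetric i k ▸ h) hk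
    · exact add_pos (pos i hi) (pos k hk)

theorem isLeftDescent_iff_rootPairing_neg {w : W} {i : I} :
    cs.IsLeftDescent w i ↔ rootPairing cs hM w i < 0 := by
  constructor
  · intro h
    have := (rootPairing_pos_and_add_pos cs hM (cs.simple i * w)).1 i
      (cs.isLeftDescent_iff_not_isLeftDescent_mul.1 h)
    rwa [rootPairing_simple_mul_self, neg_pos] at this
  · intro h
    by_contra hi
    exact lt_asymm h ((rootPairing_pos_and_add_pos cs hM w).1 i hi)

include hM

theorem eq_of_isLeftDescent_simple {i k : I} (h : cs.IsLeftDescent (cs.simple i) k) : k = i := by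
  by_contra hki
  rw [isLeftDescent_iff_rootPairing_neg cs hM, ← mul_one (cs.simple i)] at h
  rcases hM i k (Ne.symm hki) with hik | hik
  · rw [rootPairing_simple_mul_of_eq_two cs hM hik, rootPairing_one] at h
    norm_num at h
  · rw [rootPairing_simple_mul_of_eq_zero cs hM hik, rootPairing_one, rootPairing_one] at h
    norm_num at h

theorem simple_injective : Function.Injective cs.simple := fun i k h =>
  eq_of_isLeftDescent_simple cs hM <| by
    rw [← h, CoxeterSystem.IsLeftDescent, cs.simple_mul_simple_self, cs.length_one,
      cs.length_simple]
    exact one_pos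

theorem isLeftDescent_simple_mul_iff {i k : I} (h : M k i = 2) {w : W} :
    cs.IsLeftDescent (cs.simple k * w) i ↔ cs.IsLeftDescent w i := by
  rw [isLeftDescent_iff_rootPairing_neg cs hM, isLeftDescent_iff_rootPairing_neg cs hM,
    rootPairing_simple_mul_of_eq_two cs hM h]

theorem eq_two_of_isLeftDescent {w : W} {i k : I} (hik : i ≠ k) (hi : cs.IsLeftDescent w i)
    (hk : cs.IsLeftDescent w k) : M i k = 2 := by
  refine (hM i k hik).resolve_right fun h => ?_
  rw [isLeftDescent_iff_rootPairing_neg cs hM] at hi hk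
  exact lt_asymm (add_neg hi hk) ((rootPairing_pos_and_add_pos cs hM w).2 i k h)

/- The hypotheses on `i` say that `w` carries the wall of `j` to the wall of `i`, so that a reduced
word for `w` only involves letters commuting with `i`. -/
theorem eq_two_of_isLeftDescent_mul_simple {w : W} {i j k : I} (hi : ¬ cs.IsLeftDescent w i)
    (hij : cs.IsLeftDescent (w * cs.simple j) i) (hk : cs.IsLeftDescent w k) : M i k = 2 :=
  eq_two_of_isLeftDescent cs hM (fun h => hi (h ▸ hk)) hij
    (isLeftDescent_mul_simple cs hk (length_mul_simple_of_isLeftDescent cs hi hij))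

end RightAngledCoxeter
namespace ChamberSystem

variable {I C : Type*} {S : ChamberSystem I C}

theorem Adj.symm {i : I} {c d : C} (h : S.Adj i c d) : S.Adj i d c :=
  ⟨h.1.symm, (S.panelSetoid i).symm' h.2⟩

namespace IsGallery

variable {c d e : C} {f g : List I} {γ γ' : List C}

theorem length_eq (h : S.IsGallery c f γ d) : γ.length = f.length + 1 := by
  induction h with
  | nil c => rfl
  | cons _ _ ih => rw [List.length_cons, ih, List.length_cons]

theorem append (h : S.IsGallery c f γ d) (h' : S.IsGallery d g γ' e) :
    ∃ γ'', S.IsGallery c (f ++ g) γ'' e := by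
  induction h with
  | nil c => exact ⟨γ', h'⟩
  | cons hadj _ ih =>
    obtain ⟨γ'', h''⟩ := ih h'
    exact ⟨_, h''.cons hadj⟩

theorem reverse (h : S.IsGallery c f γ d) : ∃ γ', S.IsGallery d f.reverse γ' c := by
  induction h with
  | nil c => exact ⟨_, nil c⟩
  | cons hadj _ ih =>
    obtain ⟨γ', h'⟩ := ih
    rw [List.reverse_cons]
    exact h'.append (cons hadj.symm (nil _))

theorem exists_eq_append_of_mem (h : S.IsGallery c f γ d) (he : e ∈ γ) :
    ∃ f₁ γ₁ f₂ γ₂, f = f₁ ++ f₂ ∧ S.IsGallery c f₁ γ₁ e ∧ S.IsGallery e f₂ γ₂ d := by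
  induction h with
  | nil c =>
    obtain rfl := List.mem_singleton.1 he
    exact ⟨[], [e], [], [e], rfl, nil e, nil e⟩
  | cons hadj hγ ih =>
    rcases List.mem_cons.1 he with rfl | he
    · exact ⟨[], [e], _, _, rfl, nil e, cons hadj hγ⟩
    · obtain ⟨f₁, γ₁, f₂, γ₂, rfl, h₁, h₂⟩ := ih he
      exact ⟨_ :: f₁, _, f₂, γ₂, rfl, cons hadj h₁, h₂⟩

end IsGallery

end ChamberSystem

namespace Building

open ChamberSystem

variable {I : Type*} {M : CoxeterMatrix I} {C : Type*} (Δ : Building M C)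

theorem exists_reduced_gallery (c d : C) : ∃ f γ, M.toCoxeterSystem.IsReduced f ∧
    Δ.δ c d = M.toCoxeterSystem.wordProd f ∧ Δ.IsGallery c f γ d := by
  obtain ⟨f, hf, h⟩ := M.toCoxeterSystem.exists_isReduced (Δ.δ c d)
  obtain ⟨γ, hγ⟩ := (Δ.δ_eq_iff f hf c d).1 h
  exact ⟨f, γ, hf, h, hγ⟩

theorem δ_eq_one_iff {c d : C} : Δ.δ c d = 1 ↔ c = d := by
  have hnil : M.toCoxeterSystem.IsReduced [] := by simp [CoxeterSystem.IsReduced]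
  rw [← M.toCoxeterSystem.wordProd_nil, Δ.δ_eq_iff [] hnil]
  constructor
  · rintro ⟨γ, ⟨⟩⟩
    rfl
  · rintro rfl
    exact ⟨_, IsGallery.nil c⟩

theorem δ_self (c : C) : Δ.δ c c = 1 := Δ.δ_eq_one_iff.2 rfl

theorem δ_inv (c d : C) : (Δ.δ c d)⁻¹ = Δ.δ d c := by
  obtain ⟨f, γ, hf, h, hγ⟩ := Δ.exists_reduced_gallery c d
  rw [(Δ.δ_eq_iff f.reverse hf.reverse d c).2 hγ.reverse, h, CoxeterSystem.wordProd_reverse]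

theorem δ_eq_simple_mul {i : I} {c d e : C} (h : Δ.Adj i c d)
    (hd : ¬ M.toCoxeterSystem.IsLeftDescent (Δ.δ d e) i) :
    Δ.δ c e = M.toCoxeterSystem.simple i * Δ.δ d e := by
  obtain ⟨f, γ, hf, hδ, hγ⟩ := Δ.exists_reduced_gallery d e
  rw [CoxeterSystem.not_isLeftDescent_iff, hδ, hf.eq, ← CoxeterSystem.wordProd_cons] at hd
  rw [hδ, ← CoxeterSystem.wordProd_cons]
  exact (Δ.δ_eq_iff (i :: f) hd c e).2 ⟨_, hγ.cons h⟩

theorem exists_adj_of_isLeftDescent {i : I} {c e : C}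
    (h : M.toCoxeterSystem.IsLeftDescent (Δ.δ c e) i) :
    ∃ d, Δ.Adj i c d ∧ Δ.δ d e = M.toCoxeterSystem.simple i * Δ.δ c e := by
  obtain ⟨f, hf, hw⟩ :=
    M.toCoxeterSystem.exists_isReduced (M.toCoxeterSystem.simple i * Δ.δ c e)
  have hδ : Δ.δ c e = M.toCoxeterSystem.wordProd (i :: f) := by
    rw [CoxeterSystem.wordProd_cons, ← hw, CoxeterSystem.simple_mul_simple_cancel_left]
  have hred : M.toCoxeterSystem.IsReduced (i :: f) := by
    rw [CoxeterSystem.isLeftDescent_iff, hw, hf.eq] at h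
    rw [CoxeterSystem.IsReduced, ← hδ, ← h, List.length_cons]
  obtain ⟨γ, hγ⟩ := (Δ.δ_eq_iff _ hred c e).1 hδ
  cases hγ with
  | cons hadj hγ' => exact ⟨_, hadj, hw ▸ (Δ.δ_eq_iff f hf _ e).2 ⟨_, hγ'⟩⟩

theorem δ_eq_or_of_adj {i : I} {c d : C} (h : Δ.Adj i c d) (e : C) :
    Δ.δ c e = M.toCoxeterSystem.simple i * Δ.δ d e ∨ Δ.δ c e = Δ.δ d e := by
  by_cases hd : M.toCoxeterSystem.IsLeftDescent (Δ.δ d e) i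
  · obtain ⟨d', hd', hδ⟩ := Δ.exists_adj_of_isLeftDescent hd
    obtain rfl | hc := eq_or_ne c d'
    · exact Or.inl hδ
    · have hd'e : ¬ M.toCoxeterSystem.IsLeftDescent (Δ.δ d' e) i :=
        hδ ▸ CoxeterSystem.isLeftDescent_iff_not_isLeftDescent_mul _ |>.1 hd
      right
      rw [Δ.δ_eq_simple_mul ⟨hc, (Δ.panelSetoid i).trans' h.2 hd'.2⟩ hd'e, hδ,
        CoxeterSystem.simple_mul_simple_cancel_left]
  · exact Or.inl (Δ.δ_eq_simple_mul h hd)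

theorem δ_eq_or_of_adj_right {i : I} {d e : C} (h : Δ.Adj i d e) (c : C) :
    Δ.δ c e = Δ.δ c d * M.toCoxeterSystem.simple i ∨ Δ.δ c e = Δ.δ c d := by
  rw [← Δ.δ_inv e c, ← Δ.δ_inv d c]
  rcases Δ.δ_eq_or_of_adj h.symm c with h | h
  · rw [h, mul_inv_rev, CoxeterSystem.inv_simple]
    exact Or.inl rfl
  · exact Or.inr (congrArg _ h)

/-- The gallery distance between two chambers. -/
noncomputable def dist (c d : C) : ℕ := M.toCoxeterSystem.length (Δ.δ c d)

theorem dist_le_of_isGallery {c d : C} {f : List I} {γ : List C} (h : Δ.IsGallery c f γ d) :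
    Δ.dist c d ≤ f.length := by
  unfold dist
  induction h with
  | nil c => rw [δ_self, CoxeterSystem.length_one, List.length_nil]
  | @cons i f c d e γ hadj _ ih =>
    rw [List.length_cons]
    rcases Δ.δ_eq_or_of_adj hadj e with h | h <;> rw [h]
    · have := M.toCoxeterSystem.length_simple_mul (Δ.δ d e) i
      omega
    · omega

theorem exists_isGallery_length_eq_dist (c d : C) :
    ∃ f γ, Δ.IsGallery c f γ d ∧ f.length = Δ.dist c d := by
  obtain ⟨f, γ, hf, h, hγ⟩ := Δ.exists_reduced_gallery c d
  exact ⟨f, γ, hγ, by rw [dist, h, hf.eq]⟩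

theorem dist_triangle (c d e : C) : Δ.dist c e ≤ Δ.dist c d + Δ.dist d e := by
  obtain ⟨f, γ, hγ, hf⟩ := Δ.exists_isGallery_length_eq_dist c d
  obtain ⟨g, γ', hγ', hg⟩ := Δ.exists_isGallery_length_eq_dist d e
  obtain ⟨γ'', h⟩ := hγ.append hγ'
  rw [← hf, ← hg, ← List.length_append]
  exact Δ.dist_le_of_isGallery h

theorem dist_le_one_of_adj {i : I} {c d : C} (h : Δ.Adj i c d) : Δ.dist c d ≤ 1 :=
  Δ.dist_le_of_isGallery (IsGallery.cons h (IsGallery.nil d))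

theorem exists_adj_dist_eq_add_one {i : I} {c e : C}
    (h : M.toCoxeterSystem.IsLeftDescent (Δ.δ c e) i) :
    ∃ d, Δ.Adj i c d ∧ Δ.dist c e = Δ.dist d e + 1 := by
  obtain ⟨d, hd, hδ⟩ := Δ.exists_adj_of_isLeftDescent h
  refine ⟨d, hd, ?_⟩
  rw [dist, dist, hδ]
  exact (M.toCoxeterSystem.isLeftDescent_iff.1 h).symm

theorem dist_add_dist_of_mem_isMinimalGallery {c d e : C} {γ : List C}
    (hγ : Δ.IsMinimalGallery c γ d) (he : e ∈ γ) :
    Δ.dist c e + Δ.dist e d = Δ.dist c d := by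
  obtain ⟨⟨f, hf⟩, hmin⟩ := hγ
  obtain ⟨g, γ', hg, hg_length⟩ := Δ.exists_isGallery_length_eq_dist c d
  have hle := hmin g γ' hg
  rw [hf.length_eq, hg.length_eq, hg_length] at hle
  obtain ⟨f₁, γ₁, f₂, γ₂, rfl, h₁, h₂⟩ := hf.exists_eq_append_of_mem he
  rw [List.length_append] at hle
  have := Δ.dist_le_of_isGallery h₁
  have := Δ.dist_le_of_isGallery h₂
  have := Δ.dist_triangle c e d
  omega

/-- The chamber `r` is the projection of the chamber `x` to the `i`-panel of `r`, that is, the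
chamber of that panel nearest to `x`. -/
def IsGate (i : I) (r x : C) : Prop := ¬ M.toCoxeterSystem.IsLeftDescent (Δ.δ r x) i

variable {Δ}

theorem isGate_self (i : I) (x : C) : Δ.IsGate i x x := by
  rw [IsGate, δ_self]
  exact M.toCoxeterSystem.not_isLeftDescent_one i

theorem exists_isGate (i : I) (c x : C) : ∃ r, (Δ.panelSetoid i) c r ∧ Δ.IsGate i r x := by
  by_cases h : M.toCoxeterSystem.IsLeftDescent (Δ.δ c x) i
  · obtain ⟨d, hd, hδ⟩ := Δ.exists_adj_of_isLeftDescent h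
    refine ⟨d, hd.2, ?_⟩
    rw [IsGate, hδ]
    exact (CoxeterSystem.isLeftDescent_iff_not_isLeftDescent_mul _).1 h
  · exact ⟨c, (Δ.panelSetoid i).refl' c, h⟩

theorem IsGate.eq {i : I} {r r' x : C} (h : Δ.IsGate i r x) (h' : Δ.IsGate i r' x)
    (hr : (Δ.panelSetoid i) r r') : r = r' := by
  by_contra hne
  rw [IsGate, Δ.δ_eq_simple_mul ⟨hne, hr⟩ h'] at h
  exact h' ((CoxeterSystem.isLeftDescent_iff_not_isLeftDescent_mul _).2 h)

theorem isGate_of_dist_lt {i : I} {c r x : C} (hc : Δ.Adj i c r)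
    (h : Δ.dist r x < Δ.dist c x) : Δ.IsGate i r x := by
  intro hd
  unfold dist at h
  rcases Δ.δ_eq_or_of_adj hc x with hδ | hδ <;> rw [hδ] at h
  · exact lt_asymm h hd
  · exact lt_irrefl _ h

variable (Δ) in
/-- The partition of the chambers into the `i`-wings of the `i`-panel of `c`: two chambers are
related if they have the same projection to this panel. -/
def wingSetoid (i : I) (c : C) : Setoid C where
  r x y := ∃ r, (Δ.panelSetoid i) c r ∧ Δ.IsGate i r x ∧ Δ.IsGate i r y
  iseqv :=
    { refl x := by
        obtain ⟨r, hr, hx⟩ := exists_isGate (Δ := Δ) i c x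
        exact ⟨r, hr, hx, hx⟩
      symm := fun ⟨r, hr, hx, hy⟩ => ⟨r, hr, hy, hx⟩
      trans := fun ⟨r, hr, hx, hy⟩ ⟨r', hr', hy', hz⟩ => by
        obtain rfl := hy.eq hy' ((Δ.panelSetoid i).trans' ((Δ.panelSetoid i).symm' hr) hr')
        exact ⟨r, hr, hx, hz⟩ }

theorem wingSetoid_congr {i : I} {c d : C} (h : (Δ.panelSetoid i) c d) :
    Δ.wingSetoid i c = Δ.wingSetoid i d := by
  ext x y
  exact exists_congr fun r => and_congr_left fun _ =>
    ⟨(Δ.panelSetoid i).trans' ((Δ.panelSetoid i).symm' h), (Δ.panelSetoid i).trans' h⟩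

theorem eq_of_forall_wingSetoid {x y : C} (h : ∀ i c, Δ.wingSetoid i c x y) : x = y := by
  by_contra hne
  obtain ⟨i, hi⟩ := M.toCoxeterSystem.exists_leftDescent_of_ne_one (mt Δ.δ_eq_one_iff.1 hne)
  obtain ⟨r, hr, hx, hy⟩ := h i x
  rw [← (isGate_self i x).eq hx hr] at hy
  exact hy hi

variable (Δ) in
/-- The partitions into wings that arise from the panels of the building. They play the role of the
walls of a Coxeter complex: a partition separates two chambers that are not related by it. -/
def wingPartitions : Set (Setoid C) := {W | ∃ i c, Δ.wingSetoid i c = W}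

variable (hM : M.IsRightAngled)
include hM

theorem isGate_iff_of_adj {i k : I} (h : M i k = 2) {r r' x : C} (hr : Δ.Adj k r r') :
    Δ.IsGate i r x ↔ Δ.IsGate i r' x := by
  unfold IsGate
  rcases Δ.δ_eq_or_of_adj hr x with hδ | hδ
  · rw [hδ, RightAngledCoxeter.isLeftDescent_simple_mul_iff _ hM (M.symmetric i k ▸ h)]
  · rw [hδ]

theorem exists_adj_adj_of_eq_two {i k : I} (h : M i k = 2) {r c c' : C}
    (hrc : Δ.Adj i r c) (hc : Δ.Adj k c c') : ∃ r', Δ.Adj k r r' ∧ Δ.Adj i r' c' := by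
  have hik : i ≠ k := by
    rintro rfl
    simp at h
  have hne := (RightAngledCoxeter.simple_injective M.toCoxeterSystem hM).ne hik
  have hδ : Δ.δ r c' = M.toCoxeterSystem.wordProd [i, k] :=
    (Δ.δ_eq_iff _ (RightAngledCoxeter.isReduced_pair _ hne) r c').2
      ⟨_, .cons hrc (.cons hc (.nil c'))⟩
  have hswap : M.toCoxeterSystem.wordProd [i, k] = M.toCoxeterSystem.wordProd [k, i] := by
    simpa only [CoxeterSystem.wordProd_cons, CoxeterSystem.wordProd_nil, mul_one] using
      (RightAngledCoxeter.commute_simple_of_eq_two M.toCoxeterSystem h).eq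
  obtain ⟨γ, hγ⟩ :=
    (Δ.δ_eq_iff _ (RightAngledCoxeter.isReduced_pair _ hne.symm) r c').1 (hδ.trans hswap)
  rcases hγ with _ | ⟨hk, _ | ⟨hi, ⟨⟩⟩⟩
  exact ⟨_, hk, hi⟩

theorem wingSetoid_le_of_adj {i k : I} (h : M i k = 2) {c c' : C} (hc : Δ.Adj k c c') :
    Δ.wingSetoid i c ≤ Δ.wingSetoid i c' := by
  rintro x y ⟨r, hr, hx, hy⟩
  obtain rfl | hrc := eq_or_ne r c
  · exact ⟨c', (Δ.panelSetoid i).refl' c', (isGate_iff_of_adj hM h hc).1 hx,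
      (isGate_iff_of_adj hM h hc).1 hy⟩
  · obtain ⟨r', hk, hi⟩ :=
      exists_adj_adj_of_eq_two hM h ⟨hrc, (Δ.panelSetoid i).symm' hr⟩ hc
    exact ⟨r', hi.symm.2, (isGate_iff_of_adj hM h hk).1 hx, (isGate_iff_of_adj hM h hk).1 hy⟩

theorem wingSetoid_eq_of_adj {i k : I} (h : M i k = 2) {c c' : C} (hc : Δ.Adj k c c') :
    Δ.wingSetoid i c = Δ.wingSetoid i c' :=
  le_antisymm (wingSetoid_le_of_adj hM h hc) (wingSetoid_le_of_adj hM h hc.symm)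

/- Such panels are parallel. Moving `c` towards `p` along a minimal gallery crosses only panels of
types commuting with `i`, which do not change the partition, until the two panels coincide. -/
theorem wingSetoid_eq_of_isGate_of_not_isGate {i j : I} {c p p' : C} (hp : Δ.Adj j p p')
    (hc : Δ.IsGate i c p) (hc' : ¬ Δ.IsGate i c p') : Δ.wingSetoid i c = Δ.wingSetoid j p := by
  induction hn : Δ.dist c p using Nat.strong_induction_on generalizing c with
  | _ n ih =>
    have hδ : Δ.δ c p' = Δ.δ c p * M.toCoxeterSystem.simple j :=
      (Δ.δ_eq_or_of_adj_right hp c).resolve_right fun hδ => hc' (by rwa [IsGate, hδ])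
    have hdescent : M.toCoxeterSystem.IsLeftDescent (Δ.δ c p * M.toCoxeterSystem.simple j) i :=
      hδ ▸ not_not.1 hc'
    obtain rfl | hcp := eq_or_ne c p
    · rw [δ_self, one_mul] at hdescent
      rw [RightAngledCoxeter.eq_of_isLeftDescent_simple _ hM hdescent]
    obtain ⟨k, hk⟩ := M.toCoxeterSystem.exists_leftDescent_of_ne_one (mt Δ.δ_eq_one_iff.1 hcp)
    obtain ⟨d, hcd, hdist⟩ := Δ.exists_adj_dist_eq_add_one hk
    have hik : M i k = 2 :=
      RightAngledCoxeter.eq_two_of_isLeftDescent_mul_simple _ hM hc hdescent hk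
    rw [wingSetoid_eq_of_adj hM hik hcd]
    exact ih _ (by omega) ((isGate_iff_of_adj hM hik hcd).1 hc)
      (mt (isGate_iff_of_adj hM hik hcd).2 hc') rfl

theorem wingSetoid_eq_of_adj_of_not_rel {W : Setoid C} (hW : W ∈ Δ.wingPartitions) {i : I}
    {c d : C} (hcd : Δ.Adj i c d) (h : ¬ W c d) : Δ.wingSetoid i c = W := by
  obtain ⟨j, p, rfl⟩ := hW
  obtain ⟨r, hr, hrc⟩ := exists_isGate (Δ := Δ) j p c
  have hrd : ¬ Δ.IsGate j r d := fun hrd => h ⟨r, hr, hrc, hrd⟩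
  rw [wingSetoid_congr hr, wingSetoid_eq_of_isGate_of_not_isGate hM hcd hrc hrd]

theorem finite_setOf_wingPartitions_not_rel (c d : C) :
    {W ∈ Δ.wingPartitions | ¬ W c d}.Finite := by
  obtain ⟨f, γ, -, -, hγ⟩ := Δ.exists_reduced_gallery c d
  induction hγ with
  | nil c => exact Set.finite_empty.subset fun W hW => hW.2 (W.refl' c)
  | @cons i _ c d e _ hadj _ ih =>
    refine (ih.insert (Δ.wingSetoid i c)).subset fun W hW => ?_
    by_cases hcd : W c d
    · exact Or.inr ⟨hW.1, fun hde => hW.2 (W.trans' hcd hde)⟩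
    · exact Or.inl (wingSetoid_eq_of_adj_of_not_rel hM hW.1 hadj hcd).symm

/- The first step of a minimal gallery that leaves a wing of `W` determines `W`, and the panel
crossed there has the same gate for all later chambers of the gallery. -/
theorem rel_or_rel_of_dist_add_dist_eq {W : Setoid C} (hW : W ∈ Δ.wingPartitions) {c e d : C}
    (h : Δ.dist c e + Δ.dist e d = Δ.dist c d) : W c e ∨ W e d := by
  induction hn : Δ.dist c e generalizing c with
  | zero =>
    rw [dist, CoxeterSystem.length_eq_zero_iff, Δ.δ_eq_one_iff] at hn
    exact Or.inl (hn ▸ W.refl' c)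
  | succ n ih =>
    have hce : Δ.δ c e ≠ 1 := fun h1 => by simp [dist, h1] at hn
    obtain ⟨i, hi⟩ := M.toCoxeterSystem.exists_leftDescent_of_ne_one hce
    obtain ⟨c', hcc', hdist⟩ := Δ.exists_adj_dist_eq_add_one hi
    have := Δ.dist_triangle c c' d
    have := Δ.dist_le_one_of_adj hcc'
    have := Δ.dist_triangle c' e d
    by_cases hW' : W c c'
    · exact (ih (c := c') (by omega) (by omega)).imp_left (W.trans' hW')
    · right
      rw [← wingSetoid_eq_of_adj_of_not_rel hM hW hcc' hW']
      exact ⟨c', hcc'.2, isGate_of_dist_lt hcc' (by omega), isGate_of_dist_lt hcc' (by omega)⟩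

end Building

theorem mainTheorem11_general {I C : Type*} {M : CoxeterMatrix I} (hM : M.IsRightAngled)
    (Δ : Building M C) {F : Set C} (hF : F.Finite) :
    ∃ B : Set C, F ⊆ B ∧ B.Finite ∧ Δ.toChamberSystem.IsConvex B := by
  refine ⟨{x | ∀ W ∈ Δ.wingPartitions, ∃ f ∈ F, W x f}, ?_, ?_, ?_⟩
  · exact fun f hf W _ => ⟨f, hf, W.refl' f⟩
  · exact finite_setOf_forall_exists_rel (P := Δ.wingPartitions)
      (fun x y h => Building.eq_of_forall_wingSetoid fun i c => h _ ⟨i, c, rfl⟩)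
      (Building.finite_setOf_wingPartitions_not_rel hM) hF
  · intro c hc d hd γ hγ e he W hW
    have hdist := Δ.dist_add_dist_of_mem_isMinimalGallery hγ he
    rcases Building.rel_or_rel_of_dist_add_dist_eq hM hW hdist with hce | hed
    · exact (hc W hW).imp fun f => And.imp_right (W.trans' (W.symm' hce))
    · exact (hd W hW).imp fun f => And.imp_right (W.trans' hed)

theorem mainTheorem11 {I : Type u} [Finite I] (M : CoxeterMatrix I)
    (hM : M.IsRightAngled) {C : Type v} (Δ : Building M C) (q : I → Cardinal.{v})
    (hq : Δ.toChamberSystem.IsSemiregular q) (F : Set C) (hF : F.Finite) :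
    ∃ B : Set C, F ⊆ B ∧ B.Finite ∧ Δ.toChamberSystem.IsConvex B :=
  mainTheorem11_general hM Δ hF
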